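/- Let $p$ be a prime and let $\delta:\mathbb Z_p\to\mathbb Z_p$ be the Fermat quotient operator $\delta a=(a-a^p)/p$, with $i$-th iterate $\delta^i$ ($\delta^0 a=a$). A power series with coefficients in $\mathbb Z_p$ in finitely many variables is called restricted if its coefficients tend $p$-adically to $0$ as the total degree of the monomials tends to infinity. Let $m\ge 0$ be an integer and let $f:\mathbb Z_p\to\mathbb Z_p$ be analytic of level $m$, that is, for every $a\in\mathbb Z_p$ there is a restricted power series $F_a\in\mathbb Z_p[[x]]$ with $f(a+p^m u)=F_a(u)$ for all $u\in\mathbb Z_p$. Then $f$ is an arithmetic differential operator of order $m$, that is, there is a restricted power series $F\in\mathbb Z_p[[x_0,\dots,x_m]]$ with $f(a)=F(a,\delta a,\dots,\delta^m a)$ for all $a\in\mathbb Z_p$. More precisely, there is a unique restricted power series $F\in\mathbb Z_p[[x_0,\dots,x_m]]$ such that 1. every monomial that occurs in $F$ with nonzero coefficient has degree at most $p-1$ in each of the variables $x_0,\dots,x_{m-1}$ (with no condition on the degree in $x_m$), i.e. $F=\sum_{n\ge 0}\sum_{0\le\beta_0,\dots,\beta_{m-1}\le p-1}a_{\beta,n}\,x_0^{\beta_0}\cdots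 x_{m-1}^{\beta_{m-1}}x_m^{n}$; and 2. $f(a)=F(a,\delta a,\dots,\delta^m a)$ for all $a\in\mathbb Z_p$. -/

import Mathlib

noncomputable section

/-- By Fermat's little theorem in the residue field, `p` divides `a - a ^ p` in `ℤ_p`. -/
theorem PadicInt.natCast_dvd_sub_pow (p : ℕ) [Fact p.Prime] (a : ℤ_[p]) :
    (p : ℤ_[p]) ∣ a - a ^ p := by
  rw [← Ideal.mem_span_singleton, ← PadicInt.maximalIdeal_eq_span_p, ← PadicInt.ker_toZMod,
    RingHom.mem_ker, map_sub, map_pow, ZMod.pow_card, sub_self]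

/-- The Fermat quotient operator `δ a = (a - a ^ p) / p` on `ℤ_p`, the division being
performed in `ℚ_p`. -/
def fermatQuotient (p : ℕ) [Fact p.Prime] (a : ℤ_[p]) : ℤ_[p] :=
  ⟨((a : ℚ_[p]) - (a : ℚ_[p]) ^ p) / (p : ℚ_[p]), by
    obtain ⟨b, hb⟩ := PadicInt.natCast_dvd_sub_pow p a
    have hp : (p : ℚ_[p]) ≠ 0 := Nat.cast_ne_zero.mpr (Fact.out : p.Prime).ne_zero
    have h : (a : ℚ_[p]) - (a : ℚ_[p]) ^ p = (p : ℚ_[p]) * (b : ℚ_[p]) := by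
      exact_mod_cast congrArg (fun x : ℤ_[p] => (x : ℚ_[p])) hb
    rw [h, mul_div_cancel_left₀ _ hp]
    exact b.2⟩

/-- `f` is analytic of level `m`: for every `a` there is a restricted power series `G` in one
variable over `ℤ_p` (coefficients tending to `0`) with `f (a + p ^ m * u) = G u` for all `u`,
where `G u` is the sum of the series, its convergence being part of the assertion. -/
def IsAnalyticOfLevel (p : ℕ) [Fact p.Prime] (m : ℕ) (f : ℤ_[p] → ℤ_[p]) : Prop :=
  ∀ a : ℤ_[p], ∃ G : PowerSeries ℤ_[p], PowerSeries.IsRestricted 1 G ∧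
    ∀ u : ℤ_[p], HasSum (fun n : ℕ => PowerSeries.coeff n G * u ^ n)
      (f (a + (p : ℤ_[p]) ^ m * u))

/-- The power series `F` in `x_0, …, x_m` `δ`-represents `f`: for every `a` the series
`F (a, δ a, …, δ^m a)` converges, with sum `f a`. -/
def DeltaRepresents (p : ℕ) [Fact p.Prime] (m : ℕ) (F : MvPowerSeries (Fin (m + 1)) ℤ_[p])
    (f : ℤ_[p] → ℤ_[p]) : Prop :=
  ∀ a : ℤ_[p], HasSum
    (fun α : Fin (m + 1) →₀ ℕ =>
      MvPowerSeries.coeff α F * ∏ i : Fin (m + 1), ((fermatQuotient p)^[(i : ℕ)] a) ^ α i)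
    (f a)

/-- `f` is an arithmetic differential operator of order `m`: some restricted power series
(coefficients tending to `0`) in `x_0, …, x_m` over `ℤ_p` `δ`-represents `f`. -/
def IsArithmeticDiffOp (p : ℕ) [Fact p.Prime] (m : ℕ) (f : ℤ_[p] → ℤ_[p]) : Prop :=
  ∃ F : MvPowerSeries (Fin (m + 1)) ℤ_[p],
    MvPowerSeries.IsRestricted (fun _ => 1) F ∧ DeltaRepresents p m F f

/-- All monomials occurring in `F` have degree at most `p - 1` in each of the variables
`x_0, …, x_{m-1}`; the degree in `x_m` is unconstrained. -/
def HasCanonicalMonomials (p : ℕ) [Fact p.Prime] (m : ℕ)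
    (F : MvPowerSeries (Fin (m + 1)) ℤ_[p]) : Prop :=
  ∀ α : Fin (m + 1) →₀ ℕ, MvPowerSeries.coeff α F ≠ 0 → ∀ i : Fin m, α i.castSucc ≤ p - 1

end

/-! On the set of `a` for which `a, δ a, …, δ^(m-1) a` have prescribed residues `e ∈ 𝔽_p^m`, which
is a coset `b + p ^ m ℤ_p`, the jet `(a, δ a, …, δ^m a)` is a polynomial function of the parameter
`u = (a - b) / p ^ m`, and for a suitable `b` it reduces modulo `p` to `(e, u)`. Substituting the
jet into a polynomial therefore specializes `x_0, …, x_{m-1}` to `e` modulo `p`. Since the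
polynomials of degree at most `p - 1` in each of `m` variables represent every function on
`𝔽_p^m` exactly once, canonical polynomials over `𝔽_p` correspond bijectively to families of
polynomials in `u` indexed by `e`. Surjectivity approximates `f` modulo `p` by a canonical
polynomial in the jet, with a remainder `p g` where `g` is again analytic on each coset, and
iterating gives existence. By injectivity and the identity theorem for power series in `u`, a
canonical series representing `0` is divisible by `p`, hence by all powers of `p`, which gives
uniqueness. -/

open Filter Topology Polynomial

section TopologicalRing

theorem dvd_of_hasSum {ι R : Type*} [CommRing R] [TopologicalSpace R] [ContinuousMul R]
    [CompactSpace R] [T2Space R] {g : ι → R} {d y : R} (hg : HasSum g y) (hd : ∀ i, d ∣ g i) :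
    d ∣ y := by
  have hclosed : IsClosed (Set.range (d * ·)) :=
    (isCompact_range (continuous_const_mul d)).isClosed
  obtain ⟨z, hz⟩ := hclosed.mem_of_tendsto hg <| .of_forall fun s =>
    (Finset.dvd_sum fun i _ => hd i : d ∣ ∑ i ∈ s, g i).imp fun _ h => h.symm
  exact ⟨z, hz.symm⟩

theorem eq_zero_of_forall_dvd {R : Type*} [CommRing R] [IsDomain R] (hR : ¬ IsField R) {r : R}
    (h : ∀ u ≠ 0, u ∣ r) : r = 0 := by
  by_contra hr
  refine hR ⟨exists_pair_ne R, mul_comm, fun {u} hu => ?_⟩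
  obtain ⟨v, hv⟩ := h (r * u) (mul_ne_zero hr hu)
  exact ⟨v, mul_left_cancel₀ hr (by rw [mul_one, ← mul_assoc, ← hv])⟩

theorem eq_zero_of_forall_hasSum_mul_pow {R : Type*} [CommRing R] [IsDomain R]
    [TopologicalSpace R] [IsTopologicalRing R] [CompactSpace R] [T2Space R] (hR : ¬ IsField R)
    {c : ℕ → R} (hc : ∀ u, HasSum (fun n => c n * u ^ n) 0) (n : ℕ) : c n = 0 := by
  induction n using Nat.strong_induction_on with
  | _ n ih =>
    refine eq_zero_of_forall_dvd hR fun u hu => ?_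
    have htail : HasSum (fun j => c (j + (n + 1)) * u ^ (j + (n + 1))) (-(c n * u ^ n)) := by
      refine (hasSum_nat_add_iff (f := fun j => c j * u ^ j) (n + 1)).2 ?_
      rw [Finset.sum_range_succ,
        Finset.sum_eq_zero fun j hj => by rw [ih j (Finset.mem_range.1 hj), zero_mul]]
      simpa using hc u
    have hdvd : u ^ (n + 1) ∣ c n * u ^ n :=
      dvd_neg.1 <| dvd_of_hasSum htail fun j => (pow_dvd_pow u (by omega)).mul_left _
    rwa [pow_succ', mul_dvd_mul_iff_right (pow_ne_zero n hu)] at hdvd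

theorem hasSum_pow_mul_sub {R : Type*} [NormedRing R] [CompleteSpace R] {x : R} (hx : ‖x‖ < 1)
    {s : ℕ → R} {B : ℝ} (hs : ∀ k, ‖s k‖ ≤ B) :
    HasSum (fun k => x ^ k * (s k - x * s (k + 1))) (s 0) := by
  have hsum : Summable fun k => x ^ k * s k := by
    refine .of_norm_bounded ((summable_norm_geometric_of_norm_lt_one hx).mul_right B) fun k => ?_
    exact (norm_mul_le _ _).trans (mul_le_mul_of_nonneg_left (hs k) (norm_nonneg _))
  have hshift := (hasSum_nat_add_iff' (f := fun k => x ^ k * s k) 1).2 hsum.hasSum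
  simpa [pow_succ, mul_sub, mul_assoc] using hsum.hasSum.sub hshift

section Domain

variable {R : Type*} [Ring R] [IsDomain R] [TopologicalSpace R] [ContinuousMul R]
  [CompactSpace R] [T2Space R] {x : R}

theorem isInducing_const_mul (hx : x ≠ 0) : IsInducing (AddMonoidHom.mulLeft x) :=
  ((continuous_const_mul x).isClosedEmbedding (mul_right_injective₀ hx)).isInducing

theorem hasSum_const_mul_iff {ι : Type*} (hx : x ≠ 0) {g : ι → R} {y : R} :
    HasSum (fun i => x * g i) (x * y) ↔ HasSum g y :=
  (isInducing_const_mul hx).hasSum_iff (g := AddMonoidHom.mulLeft x) g y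

theorem tendsto_zero_of_tendsto_const_mul_zero {ι : Type*} (hx : x ≠ 0) {l : Filter ι} {g : ι → R}
    (h : Tendsto (fun i => x * g i) l (𝓝 0)) : Tendsto g l (𝓝 0) := by
  rw [(isInducing_const_mul hx).tendsto_nhds_iff, map_zero]
  exact h

end Domain

section Ultrametric

variable {ι κ R : Type*} [NormedRing R] [IsUltrametricDist R] [CompleteSpace R]
  {c : ι → R} {a : ι → κ → R}

theorem summable_mul_of_norm_le_one {b : ι → R} (hc : Tendsto c cofinite (𝓝 0))
    (hb : ∀ i, ‖b i‖ ≤ 1) : Summable fun i => c i * b i :=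
  NonarchimedeanAddGroup.summable_of_tendsto_cofinite_zero <|
    hc.zero_mul_isBoundedUnder_le (isBoundedUnder_of ⟨1, hb⟩)

theorem summable_prod_mul_of_norm_le_one (hc : Tendsto c cofinite (𝓝 0)) (ha : ∀ i k, ‖a i k‖ ≤ 1)
    (ha0 : ∀ i, Tendsto (a i) cofinite (𝓝 0)) :
    Summable fun z : ι × κ => c z.1 * a z.1 z.2 := by
  refine NonarchimedeanAddGroup.summable_of_tendsto_cofinite_zero ?_
  rw [NormedAddGroup.tendsto_nhds_zero] at hc ⊢
  intro ε hε
  have hrow : ∀ i, {k | ¬ ‖c i * a i k‖ < ε}.Finite := fun i =>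
    Filter.eventually_cofinite.1 <| NormedAddGroup.tendsto_nhds_zero.1
      (by simpa using (ha0 i).const_mul (c i)) ε hε
  refine ((hc ε hε).biUnion fun i _ => (hrow i).image (Prod.mk i)).subset fun ⟨i, k⟩ hik => ?_
  have hi : ¬ ‖c i‖ < ε := fun h => hik <|
    ((norm_mul_le _ _).trans (mul_le_of_le_one_right (norm_nonneg _) (ha i k))).trans_lt h
  exact Set.mem_biUnion (x := i) hi ⟨k, hik, rfl⟩

variable {F : κ → R} {s : ι → R}

theorem summable_of_hasSum_mul (hc : Tendsto c cofinite (𝓝 0)) (ha : ∀ i k, ‖a i k‖ ≤ 1)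
    (hs : ∀ i, HasSum (a i) (s i)) (hF : ∀ k, HasSum (fun i => c i * a i k) (F k)) :
    Summable F :=
  have hsum := summable_prod_mul_of_norm_le_one hc ha fun i => (hs i).summable.tendsto_cofinite_zero
  (((Equiv.prodComm κ ι).hasSum_iff.2 hsum.hasSum).prod_fiberwise hF).summable

theorem hasSum_iff_of_hasSum_mul (hc : Tendsto c cofinite (𝓝 0)) (ha : ∀ i k, ‖a i k‖ ≤ 1)
    (hs : ∀ i, HasSum (a i) (s i)) (hF : ∀ k, HasSum (fun i => c i * a i k) (F k)) {y : R} :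
    HasSum F y ↔ HasSum (fun i => c i * s i) y := by
  have hsum := summable_prod_mul_of_norm_le_one hc ha fun i => (hs i).summable.tendsto_cofinite_zero
  have hcol := ((Equiv.prodComm κ ι).hasSum_iff.2 hsum.hasSum).prod_fiberwise hF
  have hrow := hsum.hasSum.prod_fiberwise fun i => (hs i).mul_left (c i)
  exact ⟨fun h => h.unique hcol ▸ hrow, fun h => h.unique hrow ▸ hcol⟩

end Ultrametric

end TopologicalRing

section Polynomials

theorem hasSum_coeff_mul_pow {R : Type*} [CommSemiring R] [TopologicalSpace R]
    (P : R[X]) (u : R) : HasSum (fun n => P.coeff n * u ^ n) (P.eval u) := by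
  rw [Polynomial.eval_eq_sum_range]
  refine hasSum_sum_of_ne_finset_zero fun n hn => ?_
  rw [Polynomial.coeff_eq_zero_of_natDegree_lt (by simpa using hn), zero_mul]

theorem hasSum_coeff_mul_map_prod_pow {R A σ : Type*} [CommSemiring R] [TopologicalSpace R]
    [CommSemiring A] [Algebra R A] [Fintype σ] (L : A →ₗ[R] R) (x : σ → A)
    (P : MvPolynomial σ R) :
    HasSum (fun α => P.coeff α * L (∏ i, x i ^ α i)) (L (MvPolynomial.aeval x P)) := by
  rw [MvPolynomial.aeval_def, MvPolynomial.eval₂_eq', map_sum]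
  simp only [← Algebra.smul_def, map_smul, smul_eq_mul]
  refine hasSum_sum_of_ne_finset_zero fun α hα => ?_
  rw [MvPolynomial.notMem_support_iff.1 hα, zero_mul]

theorem exists_polynomial_coeff_eq {R : Type*} [Semiring R] {c : ℕ → R}
    (hc : (Function.support c).Finite) : ∃ P : R[X], ∀ n, P.coeff n = c n := by
  refine ⟨∑ n ∈ hc.toFinset, Polynomial.monomial n (c n), fun n => ?_⟩
  simp [Polynomial.finsetSum_coeff, Polynomial.coeff_monomial, eq_comm]

theorem exists_mvPolynomial_coeff_eq {R σ : Type*} [CommSemiring R] {c : (σ →₀ ℕ) → R}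
    (hc : (Function.support c).Finite) : ∃ P : MvPolynomial σ R, ∀ α, P.coeff α = c α := by
  classical
  refine ⟨∑ α ∈ hc.toFinset, MvPolynomial.monomial α (c α), fun α => ?_⟩
  simp [MvPolynomial.coeff_sum, MvPolynomial.coeff_monomial, eq_comm]

theorem exists_map_eq_of_surjective {R S σ : Type*} [CommSemiring R] [CommSemiring S] {φ : R →+* S}
    (hφ : Function.Surjective φ) (Q : MvPolynomial σ S) :
    ∃ P : MvPolynomial σ R, P.map φ = Q ∧ P.support ⊆ Q.support := by
  classical
  have hlift : ∀ α, ∃ r, φ r = Q.coeff α ∧ (Q.coeff α = 0 → r = 0) := fun α => by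
    by_cases h : Q.coeff α = 0
    · exact ⟨0, by rw [map_zero, h], fun _ => rfl⟩
    · exact (hφ (Q.coeff α)).imp fun r hr => ⟨hr, fun h' => absurd h' h⟩
  choose r hr hr0 using hlift
  have hsupp : Function.support r ⊆ Q.support := fun α hα =>
    MvPolynomial.mem_support_iff.2 fun h => hα (hr0 α h)
  obtain ⟨P, hP⟩ := exists_mvPolynomial_coeff_eq (Q.support.finite_toSet.subset hsupp)
  refine ⟨P, MvPolynomial.ext _ _ fun α => by rw [MvPolynomial.coeff_map, hP, hr], fun α hα => ?_⟩
  rw [MvPolynomial.mem_support_iff, hP] at hα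
  exact hsupp hα

end Polynomials

section Specialization

variable {R : Type*} [CommSemiring R] {m : ℕ}

/-- The specialization `x_i = e_i` for `i < m`, in which the last variable `x_m` is kept and
becomes the variable of a polynomial ring. -/
noncomputable def specialize (e : Fin m → R) : MvPolynomial (Fin (m + 1)) R →ₐ[R] R[X] :=
  MvPolynomial.aeval (Fin.snoc (fun i => C (e i)) X)

theorem specialize_rename_castSucc (e : Fin m → R) (P : MvPolynomial (Fin m) R) :
    specialize e (MvPolynomial.rename Fin.castSucc P) = C (P.eval e) := by
  rw [specialize, MvPolynomial.aeval_rename]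
  have : (Fin.snoc (fun i => C (e i)) X : Fin (m + 1) → R[X]) ∘ Fin.castSucc =
      algebraMap R R[X] ∘ e := by
    ext1 i
    simp
  rw [this, MvPolynomial.aeval_algebraMap_apply]
  simp

theorem specialize_toMvPolynomial_last (e : Fin m → R) (Q : R[X]) :
    specialize e (Q.toMvPolynomial (Fin.last m)) = Q := by
  simp [specialize]

theorem degreeOf_toMvPolynomial_of_ne {σ : Type*} {i j : σ} (h : i ≠ j)
    (Q : R[X]) : (Q.toMvPolynomial j).degreeOf i = 0 := by
  rw [← Nat.le_zero, Polynomial.toMvPolynomial, Polynomial.aeval_eq_sum_range]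
  refine (MvPolynomial.degreeOf_sum_le _ _ _).trans (Finset.sup_le fun n _ => ?_)
  rw [MvPolynomial.smul_eq_C_mul]
  exact (MvPolynomial.degreeOf_C_mul_le _ _ _).trans (MvPolynomial.degreeOf_X_pow_of_ne _ h).le

end Specialization

section FiniteField

variable {K : Type*} [Field K] [Fintype K] {m : ℕ}

theorem exists_specialize_eq (Q : (Fin m → K) → K[X]) :
    ∃ P : MvPolynomial (Fin (m + 1)) K,
      (∀ i : Fin m, P.degreeOf i.castSucc ≤ Fintype.card K - 1) ∧ ∀ e, specialize e P = Q e := by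
  classical
  refine ⟨∑ e, MvPolynomial.rename Fin.castSucc (MvPolynomial.indicator e) *
    (Q e).toMvPolynomial (Fin.last m), fun i => ?_, fun e => ?_⟩
  · refine (MvPolynomial.degreeOf_sum_le _ _ _).trans <| Finset.sup_le fun e _ =>
      (MvPolynomial.degreeOf_mul_le _ _ _).trans ?_
    rw [degreeOf_toMvPolynomial_of_ne i.castSucc_ne_last, add_zero,
      MvPolynomial.degreeOf_rename_of_injective (Fin.castSucc_injective m)]
    exact MvPolynomial.degreeOf_le_iff.2 fun α hα =>
      (MvPolynomial.mem_restrictDegree _ _ _).1 (MvPolynomial.indicator_mem_restrictDegree e) α hα i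
  · rw [map_sum, Finset.sum_eq_single_of_mem e (Finset.mem_univ e)]
    · simp [specialize_rename_castSucc, specialize_toMvPolynomial_last,
        MvPolynomial.eval_indicator_apply_eq_one]
    · intro e' _ he'
      rw [map_mul, specialize_rename_castSucc,
        MvPolynomial.eval_indicator_apply_eq_zero e e' he'.symm, C_0, zero_mul]

theorem eq_zero_of_forall_specialize_eq_zero {P : MvPolynomial (Fin (m + 1)) K}
    (hP : ∀ i : Fin m, P.degreeOf i.castSucc ≤ Fintype.card K - 1)
    (h : ∀ e, specialize e P = 0) : P = 0 := by
  classical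
  refine MvPolynomial.map_injective _ (C_injective (R := K)) ?_
  rw [map_zero]
  have hdeg : ∀ i, (P.map C).degreeOf i ≤ P.degreeOf i := fun i =>
    MvPolynomial.degreeOf_le_iff.2 fun α hα =>
      MvPolynomial.degreeOf_le_iff.1 le_rfl α (MvPolynomial.support_map_subset _ _ hα)
  obtain ⟨S, hS⟩ := Infinite.exists_subset_card_eq K[X] (P.degreeOf (Fin.last m) + 1)
  refine MvPolynomial.eq_zero_of_eval_zero_at_prod_finset _
    (Fin.lastCases S fun _ => Finset.univ.image C) (fun i => (hdeg i).trans_lt ?_) fun x hx => ?_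
  · refine Fin.lastCases ?_ (fun i => ?_) i
    · simp [hS]
    · rw [Fin.lastCases_castSucc, Finset.card_image_of_injective _ C_injective, Finset.card_univ]
      exact Nat.lt_of_le_pred Fintype.card_pos (hP i)
  · have hx' : ∀ i : Fin m, ∃ e, C e = x i.castSucc := fun i => by simpa using hx i.castSucc
    choose e he using hx'
    have hcomp : (Polynomial.compRingHom (x (Fin.last m))).comp (specialize e).toRingHom =
        (MvPolynomial.eval x).comp (MvPolynomial.map C) := by
      refine MvPolynomial.ringHom_ext (fun z => by simp [specialize]) fun i => ?_
      refine Fin.lastCases ?_ (fun i => ?_) i <;> simp [specialize, ← he]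
    simpa [h e] using (RingHom.congr_fun hcomp P).symm

end FiniteField

section FermatQuotient

variable {p : ℕ} [Fact p.Prime]

theorem toZMod_eq_zero_iff {z : ℤ_[p]} : PadicInt.toZMod z = 0 ↔ (p : ℤ_[p]) ∣ z := by
  rw [← RingHom.mem_ker, PadicInt.ker_toZMod, PadicInt.maximalIdeal_eq_span_p,
    Ideal.mem_span_singleton]

theorem norm_natCast_lt_one : ‖(p : ℤ_[p])‖ < 1 :=
  (PadicInt.norm_lt_one_iff_dvd _).2 dvd_rfl

theorem natCast_mul_fermatQuotient (a : ℤ_[p]) :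
    (p : ℤ_[p]) * fermatQuotient p a = a - a ^ p := by
  have hp : (p : ℚ_[p]) ≠ 0 := Nat.cast_ne_zero.mpr (Fact.out : p.Prime).ne_zero
  apply Subtype.ext
  rw [PadicInt.coe_mul, PadicInt.coe_natCast, PadicInt.coe_sub, PadicInt.coe_pow]
  exact mul_div_cancel₀ _ hp

theorem pow_succ_dvd_pow_sub_pow {R : Type*} [CommRing R] {q k : ℕ} {x y : R}
    (hk : k ≠ 0) (h : (q : R) ^ k ∣ x - y) : (q : R) ^ (k + 1) ∣ x ^ q - y ^ q := by
  rw [← Commute.geom_sum₂_mul (Commute.all x y), pow_succ']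
  exact mul_dvd_mul (dvd_geom_sum₂_self ((dvd_pow_self _ hk).trans h)) h

theorem exists_polynomial_fermatQuotient (k : ℕ) (b : ℤ_[p]) (v : ℤ_[p][X]) :
    ∃ w : ℤ_[p][X], (p : ℤ_[p][X]) ∣ w - v ∧
      ∀ u, fermatQuotient p (b + p ^ (k + 1) * v.eval u) =
        fermatQuotient p b + p ^ k * w.eval u := by
  obtain ⟨r, hr⟩ := pow_succ_dvd_pow_sub_pow (q := p) (k := k + 1) (x := C b + p ^ (k + 1) * v)
    (y := C b) k.succ_ne_zero ⟨v, by ring⟩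
  refine ⟨v - p * r, ⟨-r, by ring⟩, fun u => ?_⟩
  apply mul_left_cancel₀ PadicInt.prime_p.ne_zero
  have hu := congrArg (eval u) hr
  simp only [eval_sub, eval_pow, eval_add, eval_C, eval_mul, eval_natCast] at hu
  rw [mul_add, natCast_mul_fermatQuotient, natCast_mul_fermatQuotient]
  simp only [eval_sub, eval_mul, eval_natCast]
  linear_combination -hu

theorem exists_polynomial_iterate_fermatQuotient (i k : ℕ) (b : ℤ_[p]) :
    ∃ w : ℤ_[p][X], (p : ℤ_[p][X]) ∣ w - X ∧
      ∀ u, (fermatQuotient p)^[i] (b + p ^ (k + i) * u) =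
        (fermatQuotient p)^[i] b + p ^ k * w.eval u := by
  induction i generalizing k with
  | zero => exact ⟨X, by simp, by simp⟩
  | succ i ih =>
    obtain ⟨v, hv, hvu⟩ := ih (k + 1)
    obtain ⟨w, hw, hwu⟩ := exists_polynomial_fermatQuotient k ((fermatQuotient p)^[i] b) v
    refine ⟨w, by simpa using dvd_add hw hv, fun u => ?_⟩
    rw [Function.iterate_succ_apply', Function.iterate_succ_apply', ← hwu, ← hvu,
      add_right_comm, add_assoc k i 1]

theorem map_toZMod_eq_of_dvd_sub {v w : ℤ_[p][X]} (h : (p : ℤ_[p][X]) ∣ w - v) :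
    w.map PadicInt.toZMod = v.map PadicInt.toZMod := by
  obtain ⟨r, hr⟩ := h
  rw [eq_add_of_sub_eq hr]
  simp

theorem toZMod_iterate_fermatQuotient_add_of_lt {i m : ℕ} (hi : i < m) (b u : ℤ_[p]) :
    PadicInt.toZMod ((fermatQuotient p)^[i] (b + p ^ m * u)) =
      PadicInt.toZMod ((fermatQuotient p)^[i] b) := by
  obtain ⟨w, -, hw⟩ := exists_polynomial_iterate_fermatQuotient i (m - i) b
  rw [Nat.sub_add_cancel hi.le] at hw
  simp [hw, Nat.sub_ne_zero_of_lt hi]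

theorem toZMod_iterate_fermatQuotient_add (m : ℕ) (b u : ℤ_[p]) :
    PadicInt.toZMod ((fermatQuotient p)^[m] (b + p ^ m * u)) =
      PadicInt.toZMod ((fermatQuotient p)^[m] b) + PadicInt.toZMod u := by
  obtain ⟨w, hwX, hw⟩ := exists_polynomial_iterate_fermatQuotient m 0 b
  rw [zero_add] at hw
  rw [hw, pow_zero, one_mul, map_add, ← eval_map_apply, map_toZMod_eq_of_dvd_sub hwX, map_X, eval_X]

theorem pow_dvd_sub_of_toZMod_iterate_fermatQuotient_eq {m : ℕ} {a b : ℤ_[p]}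
    (h : ∀ i < m, PadicInt.toZMod ((fermatQuotient p)^[i] a) =
      PadicInt.toZMod ((fermatQuotient p)^[i] b)) : (p : ℤ_[p]) ^ m ∣ a - b := by
  induction m with
  | zero => simp
  | succ m ih =>
    obtain ⟨u, hu⟩ := ih fun i hi => h i (hi.trans m.lt_succ_self)
    have hm := h m m.lt_succ_self
    rw [eq_add_of_sub_eq' hu, toZMod_iterate_fermatQuotient_add, add_eq_left] at hm
    rw [hu, pow_succ]
    exact mul_dvd_mul_left _ (toZMod_eq_zero_iff.1 hm)

theorem exists_toZMod_iterate_fermatQuotient_eq (m : ℕ) (e : ℕ → ZMod p) :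
    ∃ b : ℤ_[p], ∀ i < m, PadicInt.toZMod ((fermatQuotient p)^[i] b) = e i := by
  induction m with
  | zero => simp
  | succ m ih =>
    obtain ⟨b, hb⟩ := ih
    obtain ⟨u, hu⟩ := ZMod.ringHom_surjective PadicInt.toZMod
      (e m - PadicInt.toZMod ((fermatQuotient p)^[m] b))
    refine ⟨b + p ^ m * u, fun i hi => ?_⟩
    obtain hi | rfl := Nat.lt_succ_iff_lt_or_eq.1 hi
    · rw [toZMod_iterate_fermatQuotient_add_of_lt hi, hb i hi]
    · rw [toZMod_iterate_fermatQuotient_add, hu, add_sub_cancel]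

end FermatQuotient

section Jets

variable {p : ℕ} [Fact p.Prime] {m : ℕ}

/-- The point `(a, δ a, …, δ^m a)`. -/
noncomputable def fermatJet (p : ℕ) [Fact p.Prime] (m : ℕ) (a : ℤ_[p]) : Fin (m + 1) → ℤ_[p] :=
  fun i => (fermatQuotient p)^[(i : ℕ)] a

/-- A polynomial parametrization `u ↦ (a, δ a, …, δ^m a)`, with `a = center + p ^ m * u`, of the
jets of the points `a` such that `δ^i a` reduces to `e i` for all `i < m`. The center is normalized
so that `δ^m center` reduces to `0`; the parametrization then reduces to `u ↦ (e, u)`. -/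
structure JetChart (m : ℕ) (e : Fin m → ZMod p) where
  /-- The value of `a` at `u = 0`. -/
  center : ℤ_[p]
  /-- The components of the jet, as polynomials in `u`. -/
  poly : Fin (m + 1) → ℤ_[p][X]
  eval_poly : ∀ u i, (poly i).eval u = fermatJet p m (center + p ^ m * u) i
  map_poly : ∀ i, (poly i).map PadicInt.toZMod =
    (Fin.snoc (fun i => C (e i)) X : Fin (m + 1) → (ZMod p)[X]) i

theorem nonempty_jetChart (e : Fin m → ZMod p) : Nonempty (JetChart m e) := by
  obtain ⟨b, hb⟩ := exists_toZMod_iterate_fermatQuotient_eq (m + 1)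
    fun i => if h : i < m then e ⟨i, h⟩ else 0
  choose w hwX hw using fun i k => exists_polynomial_iterate_fermatQuotient (p := p) i k b
  refine ⟨b, fun i => C (fermatJet p m b i) + p ^ (m - i) * w i (m - i), fun u i => ?_, ?_⟩
  · have := hw i (m - i) u
    rw [Nat.sub_add_cancel (by omega)] at this
    simp [fermatJet, this]
  · refine Fin.lastCases ?_ fun i => ?_
    · simp [fermatJet, hb m m.lt_succ_self, map_toZMod_eq_of_dvd_sub (hwX m 0)]
    · simp [fermatJet, hb i (by omega), Nat.sub_ne_zero_of_lt i.2]

namespace JetChart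

variable {e : Fin m → ZMod p} (D : JetChart m e)

theorem toZMod_fermatJet_castSucc (u : ℤ_[p]) (i : Fin m) :
    PadicInt.toZMod (fermatJet p m (D.center + p ^ m * u) i.castSucc) = e i := by
  rw [← D.eval_poly, ← eval_map_apply, D.map_poly, Fin.snoc_castSucc, eval_C]

theorem exists_eq_center_add {a : ℤ_[p]}
    (ha : ∀ i : Fin m, PadicInt.toZMod (fermatJet p m a i.castSucc) = e i) :
    ∃ u, a = D.center + p ^ m * u := by
  have hcenter : ∀ i : Fin m, PadicInt.toZMod (fermatJet p m D.center i.castSucc) = e i :=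
    fun i => by simpa using D.toZMod_fermatJet_castSucc 0 i
  obtain ⟨u, hu⟩ := pow_dvd_sub_of_toZMod_iterate_fermatQuotient_eq (m := m) (a := a)
    (b := D.center) fun i hi => (ha ⟨i, hi⟩).trans (hcenter ⟨i, hi⟩).symm
  exact ⟨u, eq_add_of_sub_eq' hu⟩

theorem eval_aeval_poly (P : MvPolynomial (Fin (m + 1)) ℤ_[p]) (u : ℤ_[p]) :
    (MvPolynomial.aeval D.poly P).eval u =
      MvPolynomial.eval (fermatJet p m (D.center + p ^ m * u)) P := by
  have hom : (evalRingHom u).comp (MvPolynomial.aeval D.poly).toRingHom =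
      MvPolynomial.eval (fermatJet p m (D.center + p ^ m * u)) :=
    MvPolynomial.ringHom_ext (fun z => by simp) fun i => by simp [D.eval_poly]
  exact RingHom.congr_fun hom P

theorem map_aeval_poly (P : MvPolynomial (Fin (m + 1)) ℤ_[p]) :
    (MvPolynomial.aeval D.poly P).map PadicInt.toZMod =
      specialize e (P.map PadicInt.toZMod) := by
  have hom : (mapRingHom PadicInt.toZMod).comp (MvPolynomial.aeval D.poly).toRingHom =
      (specialize e).toRingHom.comp (MvPolynomial.map PadicInt.toZMod) :=
    MvPolynomial.ringHom_ext (fun z => by simp [specialize])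
      fun i => by simp [specialize, D.map_poly]
  exact RingHom.congr_fun hom P

end JetChart

theorem exists_jetChart_eq (D : ∀ e : Fin m → ZMod p, JetChart m e) (a : ℤ_[p]) :
    ∃ e u, a = (D e).center + p ^ m * u :=
  ⟨_, (D fun i => PadicInt.toZMod (fermatJet p m a i.castSucc)).exists_eq_center_add fun _ => rfl⟩

end Jets

section Restricted

theorem finite_support_toZMod {p : ℕ} [Fact p.Prime] {ι : Type*} {c : ι → ℤ_[p]}
    (hc : Tendsto c cofinite (𝓝 0)) :
    (Function.support fun i => PadicInt.toZMod (c i)).Finite := by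
  refine (NormedAddGroup.tendsto_nhds_zero.1 hc 1 one_pos).subset fun i hi hlt => hi ?_
  exact toZMod_eq_zero_iff.2 (PadicInt.norm_lt_one_iff_dvd _ |>.1 hlt)

theorem powerSeries_isRestricted_one_iff {R : Type*} [NormedRing R] {G : PowerSeries R} :
    PowerSeries.IsRestricted 1 G ↔ Tendsto (fun n => PowerSeries.coeff n G) cofinite (𝓝 0) := by
  rw [tendsto_zero_iff_norm_tendsto_zero, PowerSeries.isRestricted_iff]
  simp

theorem mvPowerSeries_isRestricted_one_iff {R σ : Type*} [NormedRing R] {F : MvPowerSeries σ R} :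
    MvPowerSeries.IsRestricted (fun _ => 1) F ↔
      Tendsto (fun α => MvPowerSeries.coeff α F) cofinite (𝓝 0) := by
  rw [tendsto_zero_iff_norm_tendsto_zero]
  simp [MvPowerSeries.IsRestricted, Finsupp.prod]

end Restricted

section Existence

variable {p : ℕ} [Fact p.Prime] {m : ℕ} (D : ∀ e : Fin m → ZMod p, JetChart m e) {f : ℤ_[p] → ℤ_[p]}

/-- In each of the charts, `f` is the sum of a restricted power series in the parameter `u`. -/
def IsAnalyticOnCharts (f : ℤ_[p] → ℤ_[p]) : Prop :=
  ∀ e, ∃ G : ℕ → ℤ_[p], Tendsto G cofinite (𝓝 0) ∧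
    ∀ u, HasSum (fun n => G n * u ^ n) (f ((D e).center + p ^ m * u))

theorem IsAnalyticOfLevel.isAnalyticOnCharts (hf : IsAnalyticOfLevel p m f) :
    IsAnalyticOnCharts D f := fun e =>
  (hf (D e).center).imp' (fun G n => PowerSeries.coeff n G) fun _ hG =>
    ⟨powerSeries_isRestricted_one_iff.1 hG.1, hG.2⟩

theorem exists_dvd_sub_coeff_aeval_poly {G : (Fin m → ZMod p) → ℕ → ℤ_[p]}
    (hG : ∀ e, Tendsto (G e) cofinite (𝓝 0)) :
    ∃ P : MvPolynomial (Fin (m + 1)) ℤ_[p], (∀ i : Fin m, P.degreeOf i.castSucc ≤ p - 1) ∧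
      ∀ e n, (p : ℤ_[p]) ∣ G e n - (MvPolynomial.aeval (D e).poly P).coeff n := by
  choose Q hQ using fun e => exists_polynomial_coeff_eq (finite_support_toZMod (hG e))
  obtain ⟨P₀, hP₀, hP₀Q⟩ := exists_specialize_eq Q
  obtain ⟨P, rfl, hP⟩ := exists_map_eq_of_surjective (ZMod.ringHom_surjective PadicInt.toZMod) P₀
  refine ⟨P, fun i => ?_, fun e n => ?_⟩
  · rw [ZMod.card] at hP₀
    exact MvPolynomial.degreeOf_le_iff.2 fun α hα =>
      MvPolynomial.degreeOf_le_iff.1 (hP₀ i) α (hP hα)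
  · rw [← toZMod_eq_zero_iff, map_sub, ← coeff_map, (D e).map_aeval_poly, hP₀Q, hQ, sub_self]

variable {D}

theorem IsAnalyticOnCharts.exists_eq_eval_add (hf : IsAnalyticOnCharts D f) :
    ∃ P : MvPolynomial (Fin (m + 1)) ℤ_[p], (∀ i : Fin m, P.degreeOf i.castSucc ≤ p - 1) ∧
      ∃ g, IsAnalyticOnCharts D g ∧
        ∀ a, f a = MvPolynomial.eval (fermatJet p m a) P + p * g a := by
  choose G hG hGf using hf
  obtain ⟨P, hP, hPG⟩ := exists_dvd_sub_coeff_aeval_poly D hG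
  have hdiff : ∀ e u, HasSum
      (fun n => (G e n - (MvPolynomial.aeval (D e).poly P).coeff n) * u ^ n)
      (f ((D e).center + p ^ m * u) -
        MvPolynomial.eval (fermatJet p m ((D e).center + p ^ m * u)) P) := fun e u => by
    rw [← (D e).eval_aeval_poly]
    simpa only [sub_mul] using (hGf e u).sub (hasSum_coeff_mul_pow _ u)
  have hdvd : ∀ a, (p : ℤ_[p]) ∣ f a - MvPolynomial.eval (fermatJet p m a) P := fun a => by
    obtain ⟨e, u, rfl⟩ := exists_jetChart_eq D a
    exact dvd_of_hasSum (hdiff e u) fun n => (hPG e n).mul_right _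
  choose g hg using hdvd
  choose H hH using hPG
  refine ⟨P, hP, g, fun e => ⟨H e, ?_, fun u => ?_⟩, fun a => eq_add_of_sub_eq' (hg a)⟩
  · refine tendsto_zero_of_tendsto_const_mul_zero PadicInt.prime_p.ne_zero ?_
    have hcoeff : Tendsto (MvPolynomial.aeval (D e).poly P).coeff cofinite (𝓝 0) := by
      simpa using
        (hasSum_coeff_mul_pow (MvPolynomial.aeval (D e).poly P) 1).summable.tendsto_cofinite_zero
    simpa only [hH, sub_zero] using (hG e).sub hcoeff
  · rw [← hasSum_const_mul_iff PadicInt.prime_p.ne_zero, ← hg]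
    simpa only [hH, mul_assoc] using hdiff e u

theorem IsAnalyticOnCharts.exists_hasSum_pow_mul_eval (hf : IsAnalyticOnCharts D f) :
    ∃ P : ℕ → MvPolynomial (Fin (m + 1)) ℤ_[p],
      (∀ k, ∀ i : Fin m, (P k).degreeOf i.castSucc ≤ p - 1) ∧
      ∀ a, HasSum (fun k => (p : ℤ_[p]) ^ k * MvPolynomial.eval (fermatJet p m a) (P k)) (f a) := by
  choose P hP g hg hPg using
    fun h : {h // IsAnalyticOnCharts D h} => h.2.exists_eq_eval_add
  let s : ℕ → {h // IsAnalyticOnCharts D h} := fun n => (fun h => ⟨g h, hg h⟩)^[n] ⟨f, hf⟩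
  have hs : ∀ k a, MvPolynomial.eval (fermatJet p m a) (P (s k)) =
      (s k).1 a - p * (s (k + 1)).1 a := fun k a => by
    simp only [s, Function.iterate_succ_apply', eq_sub_iff_add_eq, ← hPg]
  refine ⟨fun k => P (s k), fun k => hP _, fun a => ?_⟩
  simp only [hs]
  exact hasSum_pow_mul_sub norm_natCast_lt_one fun k => PadicInt.norm_le_one _

theorem exists_canonical_of_hasSum_pow_mul_eval {P : ℕ → MvPolynomial (Fin (m + 1)) ℤ_[p]}
    (hP : ∀ k, ∀ i : Fin m, (P k).degreeOf i.castSucc ≤ p - 1)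
    (hf : ∀ a, HasSum
      (fun k => (p : ℤ_[p]) ^ k * MvPolynomial.eval (fermatJet p m a) (P k)) (f a)) :
    ∃ F : MvPowerSeries (Fin (m + 1)) ℤ_[p],
      MvPowerSeries.IsRestricted (fun _ => 1) F ∧
        HasCanonicalMonomials p m F ∧ DeltaRepresents p m F f := by
  have hp : Tendsto (fun k => (p : ℤ_[p]) ^ k) cofinite (𝓝 0) := by
    rw [Nat.cofinite_eq_atTop]
    exact tendsto_pow_atTop_nhds_zero_of_norm_lt_one norm_natCast_lt_one
  have hsum : ∀ α, Summable fun k => (p : ℤ_[p]) ^ k * (P k).coeff α := fun α =>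
    summable_mul_of_norm_le_one hp fun _ => PadicInt.norm_le_one _
  have hexpand : ∀ (x : Fin (m + 1) → ℤ_[p]) k, HasSum
      (fun α => (P k).coeff α * ∏ i, x i ^ α i) (MvPolynomial.eval x (P k)) := fun x k =>
    hasSum_coeff_mul_map_prod_pow .id x (P k)
  choose F hF using hsum
  refine ⟨F, mvPowerSeries_isRestricted_one_iff.2 ?_, fun α hα i => ?_, fun a => ?_⟩
  · have hone := hexpand 1
    simp only [Pi.one_apply, one_pow, Finset.prod_const_one, mul_one] at hone
    exact (summable_of_hasSum_mul hp (fun _ _ => PadicInt.norm_le_one _) hone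
      hF).tendsto_cofinite_zero
  · contrapose! hα
    refine (hF α).unique ?_
    have : ∀ k, (P k).coeff α = 0 := fun k => MvPolynomial.notMem_support_iff.1 fun h =>
      hα.not_ge (MvPolynomial.degreeOf_le_iff.1 (hP k i) α h)
    simpa only [this, mul_zero] using hasSum_zero
  · refine (hasSum_iff_of_hasSum_mul hp (fun _ _ => PadicInt.norm_le_one _)
      (hexpand (fermatJet p m a)) fun α => ?_).2 (hf a)
    have hFα := (hF α).mul_right (∏ i, fermatJet p m a i ^ α i)
    simp only [mul_assoc] at hFα
    exact hFα

end Existence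

section Uniqueness

variable {p : ℕ} [Fact p.Prime] {m : ℕ} {F : MvPowerSeries (Fin (m + 1)) ℤ_[p]}

theorem JetChart.hasSum_coeff_mul_coeff_prod_poly {e : Fin m → ZMod p} (D : JetChart m e)
    (hF : MvPowerSeries.IsRestricted (fun _ => 1) F) (h0 : DeltaRepresents p m F 0) (n : ℕ) :
    HasSum (fun α => MvPowerSeries.coeff α F * (∏ i, D.poly i ^ α i).coeff n) 0 := by
  have hF' := mvPowerSeries_isRestricted_one_iff.1 hF
  have hsum : ∀ n, Summable fun α => MvPowerSeries.coeff α F * (∏ i, D.poly i ^ α i).coeff n :=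
    fun n => summable_mul_of_norm_le_one hF' fun _ => PadicInt.norm_le_one _
  choose G hG using hsum
  have hGu : ∀ u, HasSum (fun n => G n * u ^ n) 0 := fun u => by
    refine (hasSum_iff_of_hasSum_mul hF' (fun _ _ => PadicInt.norm_le_one _)
      (fun α => hasSum_coeff_mul_pow (∏ i, D.poly i ^ α i) u) fun n => ?_).2 ?_
    · simpa only [mul_assoc] using (hG n).mul_right (u ^ n)
    · simpa [eval_prod, D.eval_poly, fermatJet] using h0 (D.center + p ^ m * u)
  rw [← eq_zero_of_forall_hasSum_mul_pow (IsDiscreteValuationRing.not_isField ℤ_[p]) hGu n]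
  exact hG n

theorem dvd_coeff_of_deltaRepresents_zero
    (hF : MvPowerSeries.IsRestricted (fun _ => 1) F) (hc : HasCanonicalMonomials p m F)
    (h0 : DeltaRepresents p m F 0) (α : Fin (m + 1) →₀ ℕ) :
    (p : ℤ_[p]) ∣ MvPowerSeries.coeff α F := by
  obtain ⟨Q, hQ⟩ := exists_mvPolynomial_coeff_eq
    (finite_support_toZMod (mvPowerSeries_isRestricted_one_iff.1 hF))
  suffices hQ0 : Q = 0 by rw [← toZMod_eq_zero_iff, ← hQ, hQ0, MvPolynomial.coeff_zero]
  refine eq_zero_of_forall_specialize_eq_zero (fun i => ?_) fun e => ?_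
  · rw [ZMod.card]
    refine MvPolynomial.degreeOf_le_iff.2 fun β hβ => hc β (fun h => ?_) i
    rw [MvPolynomial.mem_support_iff, hQ, h, map_zero] at hβ
    exact hβ rfl
  · obtain ⟨D⟩ := nonempty_jetChart e
    obtain ⟨P, rfl, -⟩ := exists_map_eq_of_surjective (ZMod.ringHom_surjective PadicInt.toZMod) Q
    ext n
    have hsub := (hasSum_coeff_mul_map_prod_pow (lcoeff ℤ_[p] n) D.poly P).sub
      (D.hasSum_coeff_mul_coeff_prod_poly hF h0 n)
    rw [sub_zero, lcoeff_apply] at hsub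
    rw [← D.map_aeval_poly, coeff_map, coeff_zero, toZMod_eq_zero_iff]
    refine dvd_of_hasSum hsub fun β => ?_
    rw [lcoeff_apply, ← sub_mul]
    refine Dvd.dvd.mul_right (toZMod_eq_zero_iff.1 ?_) _
    rw [map_sub, ← hQ, MvPolynomial.coeff_map, sub_self]

theorem pow_dvd_coeff_of_deltaRepresents_zero (N : ℕ)
    (hF : MvPowerSeries.IsRestricted (fun _ => 1) F) (hc : HasCanonicalMonomials p m F)
    (h0 : DeltaRepresents p m F 0) (α : Fin (m + 1) →₀ ℕ) :
    (p : ℤ_[p]) ^ N ∣ MvPowerSeries.coeff α F := by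
  induction N generalizing F with
  | zero => simp
  | succ N ih =>
    choose E hE using dvd_coeff_of_deltaRepresents_zero hF hc h0
    let G : MvPowerSeries (Fin (m + 1)) ℤ_[p] := E
    have hFG : ∀ β, MvPowerSeries.coeff β F = p * MvPowerSeries.coeff β G := hE
    have hp : (p : ℤ_[p]) ≠ 0 := PadicInt.prime_p.ne_zero
    rw [hFG α, pow_succ']
    refine mul_dvd_mul_left _ (ih ?_ (fun β hβ => hc β ?_) fun a => ?_)
    · rw [mvPowerSeries_isRestricted_one_iff] at hF ⊢
      exact tendsto_zero_of_tendsto_const_mul_zero hp (by simpa only [hFG] using hF)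
    · rw [hFG β]
      exact mul_ne_zero hp hβ
    · rw [← hasSum_const_mul_iff hp]
      simpa only [hFG, mul_assoc, Pi.zero_apply, mul_zero] using h0 a

theorem eq_of_deltaRepresents {f : ℤ_[p] → ℤ_[p]} {G : MvPowerSeries (Fin (m + 1)) ℤ_[p]}
    (hF : MvPowerSeries.IsRestricted (fun _ => 1) F) (hFc : HasCanonicalMonomials p m F)
    (hFf : DeltaRepresents p m F f)
    (hG : MvPowerSeries.IsRestricted (fun _ => 1) G) (hGc : HasCanonicalMonomials p m G)
    (hGf : DeltaRepresents p m G f) : F = G := by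
  have hsub : MvPowerSeries.IsRestricted (fun _ => 1) (F - G) := by
    rw [sub_eq_add_neg]
    exact MvPowerSeries.isRestricted.add _ hF (MvPowerSeries.isRestricted.neg _ hG)
  have hsubc : HasCanonicalMonomials p m (F - G) := fun β hβ i => by
    by_cases h : MvPowerSeries.coeff β F = 0
    · exact hGc β (by simpa [h] using hβ) i
    · exact hFc β h i
  have hsub0 : DeltaRepresents p m (F - G) 0 := fun a => by
    simpa [sub_mul] using (hFf a).sub (hGf a)
  rw [← sub_eq_zero]
  ext α
  by_contra hα
  obtain ⟨N, hN⟩ := FiniteMultiplicity.of_prime_left PadicInt.prime_p hα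
  exact hN (pow_dvd_coeff_of_deltaRepresents_zero (N + 1) hsub hsubc hsub0 α)

end Uniqueness

theorem theorem5p1 (p : ℕ) [Fact p.Prime] (m : ℕ) (f : ℤ_[p] → ℤ_[p])
    (hf : IsAnalyticOfLevel p m f) :
    IsArithmeticDiffOp p m f ∧
      ∃! F : MvPowerSeries (Fin (m + 1)) ℤ_[p],
        MvPowerSeries.IsRestricted (fun _ => 1) F ∧
          HasCanonicalMonomials p m F ∧ DeltaRepresents p m F f := by
  have D : ∀ e : Fin m → ZMod p, JetChart m e := fun e => (nonempty_jetChart e).some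
  obtain ⟨P, hP, hPf⟩ := (hf.isAnalyticOnCharts D).exists_hasSum_pow_mul_eval
  obtain ⟨F, hF, hFc, hFf⟩ := exists_canonical_of_hasSum_pow_mul_eval hP hPf
  exact ⟨⟨F, hF, hFf⟩, F, ⟨hF, hFc, hFf⟩, fun G ⟨hG, hGc, hGf⟩ =>
    eq_of_deltaRepresents hG hGc hGf hF hFc hFf⟩
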